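/- Let $\mathcal X,\mathcal Y$ be measurable spaces and let $P$ (source) and $Q$ (target) be probability measures on $\mathcal X\times\mathcal Y$ satisfying the covariate shift condition: they have a common conditional distribution of $y$ given $x$, i.e. there is a Markov kernel $\kappa$ from $\mathcal X$ to $\mathcal Y$ with $P=P_X\otimes\kappa$ and $Q=Q_X\otimes\kappa$, where $P_X,Q_X$ are the marginals on $\mathcal X$. Let $p(x),q(x)$ be densities of $P_X,Q_X$ with respect to a $\sigma$-finite measure on $\mathcal X$, let $w^*(x)=q(x)/p(x)$ be the importance weight (with $0/0=0$ and $c/0=\infty$ for $c>0$), and let $b<\infty$ satisfy $w^*(x)\le b$ for all $x\in\mathcal X$. Let $f:\mathcal X\times\mathcal Y\to\mathbb R_{\ge0}$ be measurable, and for $\tau\ge0$ put $C_\tau(x)=\{y\in\mathcal Y: f(x,y)\ge\tau\}$ and $L_Q(C_\tau)=\Pr_{(x,y)\sim Q}[y\notin C_\tau(x)]$. Let $m\in\mathbb N$ and $\varepsilon,\delta\in(0,1)$. For integers $0\le k\le n$ let $F(k;n,\theta)=\sum_{i=0}^k\binom ni\theta^i(1-\theta)^{n-i}$, and let the Clopper–Pearson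 upper bound be $$\overline\theta(k;n,\delta)=\inf\big(\{\theta\in[0,1]: F(k;n,\theta)\le\delta\}\cup\{1\}\big).$$ For a finite sample $T$ (a multiset of labeled examples) let $U_{\mathrm{CP}}(C,T,\delta)=\overline\theta(\bar L_T(C);|T|,\delta)$, where $\bar L_T(C)$ is the number of $(x,y)\in T$ with $y\notin C(x)$. For a calibration set $S_m=((x_i,y_i))_{i=1}^m$, $V=(V_1,\dots,V_m)\in\mathbb R^m$ and $\vec w^*=(w^*(x_1),\dots,w^*(x_m))$, let $T_N(S_m,V,\vec w^*,b)$ be the sample of those $(x_i,y_i)$ with $V_i\le w^*(x_i)/b$, and let the rejection sampling Clopper–Pearson bound be $U_{\mathrm{RSCP}}(C,S_m,V,\vec w^*,b,\delta)=U_{\mathrm{CP}}(C,T_N(S_m,V,\vec w^*,b),\delta)$. Put $$\hat\tau=\hat\tau(S_m,V)=\max\{\tau\ge0: U_{\mathrm{RSCP}}(C_\tau,S_m,V,\vec w^*,b,\delta)\le\varepsilon\},$$ with $\hat\tau=0$ if no $\tau\ge0$ satisfies the constraint. Then the maximum exists whenever the constraint is feasible, and, for $S_m\sim P^m$ and, independently,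 $V\sim\mathrm{Uniform}([0,1])^m$, $$\Pr_{S_m,V}\big[L_Q(C_\tau)\le\varepsilon\ \text{ for all } 0\le\tau\le\hat\tau(S_m,V)\big]\ \ge\ 1-\delta .$$ In particular, $\Pr_{S_m,V}[L_Q(C_\tau)\le\varepsilon]\ge1-\delta$ for every (possibly data-dependent) choice of $\tau\in[0,\hat\tau(S_m,V)]$. -/

import Mathlib

open MeasureTheory ProbabilityTheory
open scoped NNReal ENNReal

noncomputable section

namespace RSCP

/-- The threshold prediction set `C_τ(x) = {y | f(x, y) ≥ τ}`. -/
def predSet {X Y : Type*} (f : X × Y → ℝ≥0) (τ : ℝ≥0) (x : X) : Set Y :=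
  {y | τ ≤ f (x, y)}

/-- The expected error `L_Q(C) = Pr_{(x,y) ∼ Q}[y ∉ C(x)]`. -/
def expErr {X Y : Type*} [MeasurableSpace X] [MeasurableSpace Y]
    (Q : Measure (X × Y)) (C : X → Set Y) : ℝ :=
  Q.real {z | z.2 ∉ C z.1}

open Classical in
/-- The empirical error count of `C` on a finite sample `T` (a multiset of labeled examples). -/
def errCount {X Y : Type*} (C : X → Set Y) (T : Multiset (X × Y)) : ℕ :=
  T.countP (fun z => z.2 ∉ C z.1)

/-- The CDF `F(k; n, θ)` of the binomial distribution with `n` trials and success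
probability `θ`. -/
def binomCDF (k n : ℕ) (θ : ℝ) : ℝ :=
  ∑ i ∈ Finset.range (k + 1), (n.choose i : ℝ) * θ ^ i * (1 - θ) ^ (n - i)

/-- The Clopper–Pearson upper bound. -/
def cpUpper (k n : ℕ) (δ : ℝ) : ℝ :=
  sInf ({θ : ℝ | θ ∈ Set.Icc (0 : ℝ) 1 ∧ binomCDF k n θ ≤ δ} ∪ {1})

/-- `U_CP(C, T, δ)`: the Clopper–Pearson bound of the error count of `C` on the sample `T`. -/
def UCP {X Y : Type*} (C : X → Set Y) (T : Multiset (X × Y)) (δ : ℝ) : ℝ :=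
  cpUpper (errCount C T) T.card δ

open Classical in
/-- Rejection sampling: keep the examples `S i` with `V i ≤ w i / b` (with multiplicity). -/
def accepted {X Y : Type*} {m : ℕ} (S : Fin m → X × Y) (V w : Fin m → ℝ) (b : ℝ) :
    Multiset (X × Y) :=
  (Finset.univ.filter (fun i => V i ≤ w i / b)).val.map S

/-- The rejection sampling Clopper–Pearson bound. -/
def URSCP {X Y : Type*} {m : ℕ} (C : X → Set Y) (S : Fin m → X × Y) (V w : Fin m → ℝ)
    (b δ : ℝ) : ℝ :=
  UCP C (accepted S V w b) δ

/-- The thresholds `τ ≥ 0` with `U_RSCP(C_τ, S, V, w, b, δ) ≤ ε`. -/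
def feasible {X Y : Type*} {m : ℕ} (f : X × Y → ℝ≥0) (S : Fin m → X × Y) (V w : Fin m → ℝ)
    (b δ ε : ℝ) : Set ℝ≥0 :=
  {τ | URSCP (predSet f τ) S V w b δ ≤ ε}

/-- The chosen threshold `τ̂`. The supremum of the empty set in `ℝ≥0` is `0`, which is the
convention for `τ̂` when the problem is infeasible. -/
def tauHat {X Y : Type*} {m : ℕ} (f : X × Y → ℝ≥0) (S : Fin m → X × Y) (V w : Fin m → ℝ)
    (b δ ε : ℝ) : ℝ≥0 :=
  sSup (feasible f S V w b δ ε)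

/-- The importance weight `w*(x) = q(x) / p(x)`, where `q(x) / 0 = ∞` if `q(x) ≠ 0`, so that a
finite bound on `w*` forces `q(x) = 0` wherever `p(x) = 0`. -/
def impWeight {X : Type*} (pX qX : X → ℝ≥0∞) (x : X) : ℝ≥0∞ :=
  qX x / pX x

/-- The vector of importance weights of the examples of `S`. -/
def weights {X Y : Type*} {m : ℕ} (pX qX : X → ℝ≥0∞) (S : Fin m → X × Y) : Fin m → ℝ :=
  fun i => (impWeight pX qX (S i).1).toReal

/-- Covariate shift: `P` and `Q` have a common conditional distribution of the label given the
covariate. -/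
def CovariateShift {X Y : Type*} [MeasurableSpace X] [MeasurableSpace Y]
    (P Q : Measure (X × Y)) : Prop :=
  ∃ κ : Kernel X Y, IsMarkovKernel κ ∧ P = P.fst ⊗ₘ κ ∧ Q = Q.fst ⊗ₘ κ

/-- The uniform distribution on `[0, 1]`. -/
def unif01 : Measure ℝ := volume.restrict (Set.Icc 0 1)

/-- The joint law of `S_m ∼ P^m` and, independently, `V ∼ Uniform([0, 1])^m`. -/
def sampleLaw {X Y : Type*} [MeasurableSpace X] [MeasurableSpace Y]
    (P : Measure (X × Y)) (m : ℕ) : Measure ((Fin m → X × Y) × (Fin m → ℝ)) :=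
  (Measure.pi fun _ => P).prod (Measure.pi fun _ => unif01)

end RSCP

end

namespace RSCP

/-! ### The binomial CDF and the Clopper–Pearson bound -/

/-! No union bound over thresholds is needed, because `Q {f < τ}` grows with `τ`: if some `τ ≤ τ̂`
is bad (error above `ε`), then `τ̂` is bad. All bad sublevel sets contain one nonrandom set `B` with
`Q B ≥ ε` (`exists_subset_lt_of_measureReal_gt`). On failure the accepted points in `B` are
therefore at most the errors of `C_τ̂`, whose Clopper–Pearson bound is at most `ε ≤ Q B`; hence the
binomial test with parameter `Q B`, applied to the count in `B`, rejects
(`binomCDF_le_of_cpUpper_le`).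

This test has level `δ`. Rejection sampling makes `Q B` the conditional probability of `B` given
acceptance (`measureReal_acceptSet_inter`), so given which indices are accepted the count is
binomial (`measureReal_pi_binomCDF_le`). -/

theorem binomCDF_succ (k n : ℕ) (θ : ℝ) :
    binomCDF (k + 1) n θ =
      binomCDF k n θ + (n.choose (k + 1) : ℝ) * θ ^ (k + 1) * (1 - θ) ^ (n - (k + 1)) := by
  simp only [binomCDF, Finset.sum_range_succ]

theorem binomCDF_mono_left (n : ℕ) {θ : ℝ} (h : θ ∈ Set.Icc (0 : ℝ) 1) :
    Monotone fun k => binomCDF k n θ := by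
  refine monotone_nat_of_le_succ fun k => ?_
  have h1 : 0 ≤ 1 - θ := sub_nonneg.2 h.2
  have h0 := h.1
  rw [binomCDF_succ, le_add_iff_nonneg_right]
  positivity

theorem binomCDF_zero_succ (n : ℕ) (θ : ℝ) :
    binomCDF 0 (n + 1) θ = (1 - θ) * binomCDF 0 n θ := by
  simp [binomCDF, pow_succ']

/-- Condition on the outcome of one trial; termwise this is Pascal's rule. -/
theorem binomCDF_succ_succ (k n : ℕ) (θ : ℝ) :
    binomCDF (k + 1) (n + 1) θ = θ * binomCDF k n θ + (1 - θ) * binomCDF (k + 1) n θ := by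
  have pascal (i : ℕ) : ((n + 1).choose (i + 1) : ℝ) * θ ^ (i + 1) * (1 - θ) ^ (n + 1 - (i + 1)) =
      θ * (n.choose i * θ ^ i * (1 - θ) ^ (n - i)) +
        (1 - θ) * (n.choose (i + 1) * θ ^ (i + 1) * (1 - θ) ^ (n - (i + 1))) := by
    rw [Nat.choose_succ_succ, Nat.add_sub_add_right]
    rcases Nat.lt_or_ge i n with hi | hi
    · obtain ⟨j, rfl⟩ := Nat.exists_eq_add_of_lt hi
      rw [show i + j + 1 - i = j + 1 by omega, show i + j + 1 - (i + 1) = j by omega]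
      push_cast
      ring
    · rw [Nat.choose_eq_zero_of_lt (Nat.lt_succ_of_le hi)]
      push_cast
      ring
  simp only [binomCDF]
  rw [Finset.sum_range_succ', Finset.sum_range_succ' _ (k + 1), Finset.sum_congr rfl
    fun i _ => pascal i, Finset.sum_add_distrib, ← Finset.mul_sum, ← Finset.mul_sum]
  simp [pow_succ']
  ring

/-- Induction on the number of trials: raising `θ` lowers both terms of the one-trial recursion and
shifts weight to the smaller one. -/
theorem binomCDF_antitoneOn (k n : ℕ) : AntitoneOn (binomCDF k n) (Set.Icc 0 1) := by
  induction n generalizing k with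
  | zero =>
    intro s _ t _ _
    simp [binomCDF, Finset.sum_range_succ']
  | succ n ih =>
    intro s hs t ht hst
    have h1 : 0 ≤ 1 - t := sub_nonneg.2 ht.2
    cases k with
    | zero =>
      rw [binomCDF_zero_succ, binomCDF_zero_succ]
      refine mul_le_mul (by linarith) (ih 0 hs ht hst) ?_ (by linarith [hs.2])
      simp only [binomCDF, zero_add, Finset.sum_range_one]
      positivity
    | succ k =>
      have hk := ih k hs ht hst
      have hk' := ih (k + 1) hs ht hst
      have hm : binomCDF k n s ≤ binomCDF (k + 1) n s := binomCDF_mono_left n hs k.le_succ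
      rw [binomCDF_succ_succ, binomCDF_succ_succ]
      calc t * binomCDF k n t + (1 - t) * binomCDF (k + 1) n t
          ≤ t * binomCDF k n s + (1 - t) * binomCDF (k + 1) n s :=
            add_le_add (mul_le_mul_of_nonneg_left hk ht.1) (mul_le_mul_of_nonneg_left hk' h1)
        _ ≤ s * binomCDF k n s + (1 - s) * binomCDF (k + 1) n s := by
            nlinarith [mul_nonneg (sub_nonneg.2 hst) (sub_nonneg.2 hm)]

theorem continuous_binomCDF (k n : ℕ) : Continuous (binomCDF k n) := by
  unfold binomCDF
  fun_prop

theorem binomCDF_self (n : ℕ) (θ : ℝ) : binomCDF n n θ = 1 := by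
  have h := add_pow θ (1 - θ) n
  rw [add_sub_cancel, one_pow] at h
  rw [h]
  exact Finset.sum_congr rfl fun i _ => by ring

theorem bddBelow_cpUpper_set (k n : ℕ) (δ : ℝ) :
    BddBelow ({θ : ℝ | θ ∈ Set.Icc (0 : ℝ) 1 ∧ binomCDF k n θ ≤ δ} ∪ {1}) := by
  refine ⟨0, ?_⟩
  rintro θ (h | rfl)
  · exact h.1.1
  · exact zero_le_one

theorem cpUpper_mono (n : ℕ) (δ : ℝ) : Monotone fun k => cpUpper k n δ := by
  intro k l hkl
  refine csInf_le_csInf (bddBelow_cpUpper_set k n δ) ⟨1, Or.inr rfl⟩ ?_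
  rintro θ (h | h)
  · exact Or.inl ⟨h.1, (binomCDF_mono_left n h.1 hkl).trans h.2⟩
  · exact Or.inr h

/-- Covers `n = 0`: an empty accepted sample yields the trivial bound. -/
theorem cpUpper_self (n : ℕ) {δ : ℝ} (hδ : δ < 1) : cpUpper n n δ = 1 := by
  have h : {θ : ℝ | θ ∈ Set.Icc (0 : ℝ) 1 ∧ binomCDF n n θ ≤ δ} = ∅ := by
    ext θ
    simp [binomCDF_self, hδ]
  rw [cpUpper, h, Set.empty_union, csInf_singleton]

/-- A success probability above a nontrivial Clopper–Pearson bound is rejected by the binomial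
test. -/
theorem binomCDF_le_of_cpUpper_le {k n : ℕ} {δ ε θ : ℝ} (hε : ε < 1) (h : cpUpper k n δ ≤ ε)
    (hεθ : ε ≤ θ) (hθ : θ ≤ 1) : binomCDF k n θ ≤ δ := by
  -- Closedness makes the infimum attained; `ε < 1` rules out attainment at the adjoined point `1`.
  have hc : IsClosed ({θ : ℝ | θ ∈ Set.Icc (0 : ℝ) 1 ∧ binomCDF k n θ ≤ δ} ∪ {1}) :=
    (isClosed_Icc.inter (isClosed_le (continuous_binomCDF k n) continuous_const)).union
      isClosed_singleton
  rcases hc.csInf_mem ⟨1, Or.inr rfl⟩ (bddBelow_cpUpper_set k n δ) with hs | hs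
  · have hst : cpUpper k n δ ≤ θ := h.trans hεθ
    exact (binomCDF_antitoneOn k n hs.1 ⟨hs.1.1.trans hst, hθ⟩ hst).trans hs.2
  · exact absurd (h.trans_lt hε) (not_lt.2 (Set.mem_singleton_iff.1 hs).ge)

/-- The binomial CDF evaluated at a binomial variable is stochastically at least uniform: the
binomial probability of `{j | F(j; n, θ) ≤ δ}` is at most `δ`. -/
theorem sum_binomial_of_binomCDF_le (n : ℕ) {θ δ : ℝ} (hθ : θ ∈ Set.Icc (0 : ℝ) 1)
    (hδ : 0 ≤ δ) :
    ∑ j ∈ Finset.range (n + 1) with binomCDF j n θ ≤ δ,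
      (n.choose j : ℝ) * θ ^ j * (1 - θ) ^ (n - j) ≤ δ := by
  have h1 : 0 ≤ 1 - θ := sub_nonneg.2 hθ.2
  have h0 := hθ.1
  rcases Finset.eq_empty_or_nonempty ({j ∈ Finset.range (n + 1) | binomCDF j n θ ≤ δ}) with he | hne
  · rw [he, Finset.sum_empty]
    exact hδ
  -- The whole sum is at most the CDF at the largest rejected count, which is at most `δ`.
  · have hmax := Finset.max'_mem _ hne
    refine le_trans ?_ (Finset.mem_filter.1 hmax).2
    refine Finset.sum_le_sum_of_subset_of_nonneg (fun j hj => ?_) fun j _ _ => by positivity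
    exact Finset.mem_range.2 (Nat.lt_succ_of_le (Finset.le_max' _ j hj))

theorem sum_powerset_of_binomCDF_le {ι : Type*} (I : Finset ι) {θ δ : ℝ}
    (hθ : θ ∈ Set.Icc (0 : ℝ) 1) (hδ : 0 ≤ δ) :
    ∑ J ∈ I.powerset with binomCDF J.card I.card θ ≤ δ,
      θ ^ J.card * (1 - θ) ^ (I.card - J.card) ≤ δ := by
  refine le_trans (le_of_eq ?_) (sum_binomial_of_binomCDF_le I.card hθ hδ)
  rw [Finset.sum_filter, Finset.sum_filter, Finset.sum_powerset_apply_card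
    fun j => if binomCDF j I.card θ ≤ δ then θ ^ j * (1 - θ) ^ (I.card - j) else 0]
  refine Finset.sum_congr rfl fun j _ => ?_
  split_ifs <;> simp [mul_assoc]

/-! ### The binomial test on a randomly thinned sample -/

open Classical in
/-- Let `E ⊆ A` be events with conditional probability `θ` of `E` given `A`. Among `m` independent
trials, the binomial test with parameter `θ`, applied to the number of occurrences of `E` among
the occurrences of `A`, has level `δ`. -/
theorem measureReal_pi_binomCDF_le {Ω : Type*} [MeasurableSpace Ω] (μ : Measure Ω)
    [IsProbabilityMeasure μ] {A E : Set Ω} (hA : MeasurableSet A) (hE : MeasurableSet E)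
    (hEA : E ⊆ A) {θ δ : ℝ} (hθ : θ ∈ Set.Icc (0 : ℝ) 1) (hδ : 0 ≤ δ)
    (h : μ.real E = μ.real A * θ) (m : ℕ) :
    (Measure.pi fun _ : Fin m => μ).real
      {ω | binomCDF (Finset.univ.filter fun i => ω i ∈ E).card
        (Finset.univ.filter fun i => ω i ∈ A).card θ ≤ δ} ≤ δ := by
  set a := μ.real A
  -- The box of outcomes where `A` occurs exactly at `I` and `E` exactly at `J`; its measure
  -- factors.
  let cell (I J : Finset (Fin m)) (i : Fin m) : Set Ω :=
    if i ∈ J then E else if i ∈ I then A \ E else Aᶜ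
  have hcell (I J : Finset (Fin m)) (hJ : J ⊆ I) :
      (Measure.pi fun _ : Fin m => μ).real (Set.univ.pi (cell I J)) =
        a ^ I.card * (1 - a) ^ (m - I.card) * (θ ^ J.card * (1 - θ) ^ (I.card - J.card)) := by
    have hsub : μ.real (A \ E) = a * (1 - θ) := by
      rw [measureReal_sdiff hEA hE, h]
      ring
    have hcompl : μ.real Aᶜ = 1 - a := probReal_compl_eq_one_sub hA
    rw [measureReal_def, Measure.pi_pi, ENNReal.toReal_prod, ← Finset.prod_mul_prod_compl I,
      ← Finset.prod_sdiff hJ]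
    have e1 : ∏ i ∈ J, (μ (cell I J i)).toReal = (a * θ) ^ J.card :=
      Finset.prod_eq_pow_card fun i hi => by
        simp only [cell, if_pos hi]
        exact h
    have e2 : ∏ i ∈ I \ J, (μ (cell I J i)).toReal = (a * (1 - θ)) ^ (I.card - J.card) := by
      rw [← Finset.card_sdiff_of_subset hJ]
      refine Finset.prod_eq_pow_card fun i hi => ?_
      rw [Finset.mem_sdiff] at hi
      simp only [cell, if_pos hi.1, if_neg hi.2]
      exact hsub
    have e3 : ∏ i ∈ Iᶜ, (μ (cell I J i)).toReal = (1 - a) ^ (m - I.card) := by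
      have hcard : Iᶜ.card = m - I.card := by rw [Finset.card_compl, Fintype.card_fin]
      rw [← hcard]
      refine Finset.prod_eq_pow_card fun i hi => ?_
      rw [Finset.mem_compl] at hi
      simp only [cell, if_neg hi, if_neg fun hj => hi (hJ hj)]
      exact hcompl
    rw [e1, e2, e3, mul_pow, mul_pow]
    have : a ^ I.card = a ^ (I.card - J.card) * a ^ J.card := by
      rw [← pow_add, Nat.sub_add_cancel (Finset.card_le_card hJ)]
    rw [this]
    ring
  have ha0 : 0 ≤ a := measureReal_nonneg
  have ha1 : 0 ≤ 1 - a := sub_nonneg.2 measureReal_le_one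
  let bad (I : Finset (Fin m)) : Finset (Finset (Fin m)) :=
    {J ∈ I.powerset | binomCDF J.card I.card θ ≤ δ}
  calc (Measure.pi fun _ : Fin m => μ).real
        {ω | binomCDF (Finset.univ.filter fun i => ω i ∈ E).card
          (Finset.univ.filter fun i => ω i ∈ A).card θ ≤ δ}
      ≤ (Measure.pi fun _ : Fin m => μ).real
          (⋃ I ∈ (Finset.univ : Finset (Finset (Fin m))), ⋃ J ∈ bad I,
            Set.univ.pi (cell I J)) := by
        refine measureReal_mono (fun ω hω => ?_) (measure_ne_top _ _)
        simp only [Set.mem_iUnion]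
        refine ⟨Finset.univ.filter fun i => ω i ∈ A, Finset.mem_univ _,
          Finset.univ.filter fun i => ω i ∈ E, ?_, ?_⟩
        · refine Finset.mem_filter.2 ⟨Finset.mem_powerset.2 fun i hi => ?_, hω⟩
          exact Finset.mem_filter.2 ⟨Finset.mem_univ i, hEA (Finset.mem_filter.1 hi).2⟩
        · intro i _
          by_cases hiE : ω i ∈ E
          · simp [cell, hiE]
          · by_cases hiA : ω i ∈ A <;> simp [cell, hiE, hiA]
    _ ≤ ∑ I : Finset (Fin m), ∑ J ∈ bad I,
          (Measure.pi fun _ : Fin m => μ).real (Set.univ.pi (cell I J)) :=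
        (measureReal_biUnion_finset_le _ _).trans
          (Finset.sum_le_sum fun I _ => measureReal_biUnion_finset_le _ _)
    _ = ∑ I : Finset (Fin m), a ^ I.card * (1 - a) ^ (m - I.card) *
          ∑ J ∈ bad I, θ ^ J.card * (1 - θ) ^ (I.card - J.card) := by
        refine Finset.sum_congr rfl fun I _ => ?_
        rw [Finset.mul_sum]
        exact Finset.sum_congr rfl fun J hJ =>
          hcell I J (Finset.mem_powerset.1 (Finset.mem_filter.1 hJ).1)
    _ ≤ ∑ I : Finset (Fin m), a ^ I.card * (1 - a) ^ (m - I.card) * δ :=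
        Finset.sum_le_sum fun I _ => mul_le_mul_of_nonneg_left
          (sum_powerset_of_binomCDF_le I hθ hδ) (by positivity)
    _ = δ := by
        rw [← Finset.sum_mul, Fin.sum_pow_mul_eq_add_pow, add_sub_cancel, one_pow, one_mul]

/-! ### Importance weights and rejection sampling -/

theorem compProd_withDensity_left {X Y : Type*} [MeasurableSpace X] [MeasurableSpace Y]
    (μ : Measure X) [SFinite μ] (κ : Kernel X Y) [IsSFiniteKernel κ] {w : X → ℝ≥0∞}
    (hw : Measurable w) :
    (μ.withDensity w) ⊗ₘ κ = (μ ⊗ₘ κ).withDensity fun z => w z.1 := by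
  ext s hs
  rw [Measure.compProd_apply hs, withDensity_apply _ hs, ← lintegral_indicator hs,
    Measure.lintegral_compProd
      (Measurable.indicator (f := fun z : X × Y => w z.1) (hw.comp measurable_fst) hs),
    lintegral_withDensity_eq_lintegral_mul _ hw (Kernel.measurable_kernel_prodMk_left hs)]
  refine lintegral_congr fun x => ?_
  have hsx : MeasurableSet (Prod.mk x ⁻¹' s) := measurable_prodMk_left hs
  rw [Pi.mul_apply, ← lintegral_indicator_one hsx, ← lintegral_const_mul _
    (measurable_one.indicator hsx)]
  refine lintegral_congr fun y => ?_
  by_cases h : (x, y) ∈ s <;> simp [h]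

/-- Where `pX` vanishes, finiteness of the weight forces `qX` to vanish too; elsewhere `pX` cancels,
being finite almost everywhere. -/
theorem withDensity_impWeight {X : Type*} [MeasurableSpace X] (ν : Measure X)
    {pX qX : X → ℝ≥0∞} (hpX : Measurable pX) (hqX : Measurable qX)
    (hfin : ∫⁻ x, pX x ∂ν ≠ ∞) (hw : ∀ x, impWeight pX qX x ≠ ∞) :
    (ν.withDensity pX).withDensity (impWeight pX qX) = ν.withDensity qX := by
  have hmeas : Measurable (impWeight pX qX) := hqX.div hpX
  rw [← withDensity_mul ν hpX hmeas]
  refine withDensity_congr_ae ?_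
  filter_upwards [ae_lt_top hpX hfin] with x hx
  rw [Pi.mul_apply, impWeight]
  rcases eq_or_ne (pX x) 0 with h0 | h0
  · have hq : qX x = 0 := by
      by_contra hq
      exact hw x (by rw [impWeight, h0, ENNReal.div_zero hq])
    simp [h0, hq]
  · exact ENNReal.mul_div_cancel h0 hx.ne

theorem CovariateShift.eq_withDensity {X Y : Type*} [MeasurableSpace X] [MeasurableSpace Y]
    {P Q : Measure (X × Y)} [IsFiniteMeasure P] (hshift : CovariateShift P Q) {w : X → ℝ≥0∞}
    (hw : Measurable w) (hQ : Q.fst = P.fst.withDensity w) :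
    Q = P.withDensity fun z => w z.1 := by
  obtain ⟨κ, _, hPκ, hQκ⟩ := hshift
  rw [hQκ, hQ, compProd_withDensity_left _ _ hw, ← hPκ]

instance : IsProbabilityMeasure unif01 := ⟨by simp [unif01]⟩

theorem unif01_Iic {t : ℝ} (ht : t ≤ 1) : unif01 (Set.Iic t) = ENNReal.ofReal t := by
  rw [unif01, Measure.restrict_apply measurableSet_Iic,
    show Set.Iic t ∩ Set.Icc 0 1 = Set.Icc 0 t from Set.ext fun v =>
      ⟨fun h => ⟨h.2.1, h.1⟩, fun h => ⟨h.2, h.1, h.2.trans ht⟩⟩, Real.volume_Icc, sub_zero]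

/-- The acceptance event of rejection sampling with weight `w` bounded by `b`. -/
def acceptSet {Z : Type*} (w : Z → ℝ≥0∞) (b : ℝ) : Set (Z × ℝ) :=
  {u | u.2 ≤ (w u.1).toReal / b}

theorem measurableSet_acceptSet {Z : Type*} [MeasurableSpace Z] {w : Z → ℝ≥0∞}
    (hw : Measurable w) (b : ℝ) : MeasurableSet (acceptSet w b) :=
  measurableSet_le measurable_snd ((hw.comp measurable_fst).ennreal_toReal.div_const b)

/-- Accepted examples have law proportional to the reweighted measure. -/
theorem measureReal_acceptSet_inter {Z : Type*} [MeasurableSpace Z] (P : Measure Z)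
    {w : Z → ℝ≥0∞} (hw : Measurable w) {b : ℝ} (hb0 : 0 < b)
    (hb : ∀ z, w z ≤ ENNReal.ofReal b) {B : Set Z} (hB : MeasurableSet B) :
    (P.prod unif01).real (acceptSet w b ∩ Prod.fst ⁻¹' B) = b⁻¹ * (P.withDensity w).real B := by
  have hslice (z : Z) : unif01 (Prod.mk z ⁻¹' (acceptSet w b ∩ Prod.fst ⁻¹' B)) =
      B.indicator (fun z => ENNReal.ofReal b⁻¹ * w z) z := by
    by_cases hz : z ∈ B
    · have hle : (w z).toReal ≤ b := ENNReal.toReal_le_of_le_ofReal hb0.le (hb z)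
      have : Prod.mk z ⁻¹' (acceptSet w b ∩ Prod.fst ⁻¹' B) = Set.Iic ((w z).toReal / b) := by
        ext v
        simp [acceptSet, hz]
      rw [this, unif01_Iic ((div_le_one hb0).2 hle), Set.indicator_of_mem hz, div_eq_inv_mul,
        ENNReal.ofReal_mul (inv_nonneg.2 hb0.le),
        ENNReal.ofReal_toReal ((hb z).trans_lt ENNReal.ofReal_lt_top).ne]
    · have : Prod.mk z ⁻¹' (acceptSet w b ∩ Prod.fst ⁻¹' B) = ∅ := by
        ext v
        simp [hz]
      rw [this, measure_empty, Set.indicator_of_notMem hz]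
  rw [measureReal_def, measureReal_def,
    Measure.prod_apply ((measurableSet_acceptSet hw b).inter (measurable_fst hB)),
    lintegral_congr hslice, lintegral_indicator hB, lintegral_const_mul _ hw,
    withDensity_apply _ hB, ENNReal.toReal_mul, ENNReal.toReal_ofReal (inv_nonneg.2 hb0.le)]

/-! ### Thresholds -/

section Thresholds

variable {X Y : Type*} {m : ℕ} (f : X × Y → ℝ≥0) (S : Fin m → X × Y) (V w : Fin m → ℝ) (b : ℝ)

open Classical in
theorem card_accepted :
    (accepted S V w b).card = (Finset.univ.filter fun i => V i ≤ w i / b).card := by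
  rw [accepted, Multiset.card_map, Finset.card_val]

open Classical in
theorem errCount_predSet_accepted (τ : ℝ≥0) :
    errCount (predSet f τ) (accepted S V w b) =
      (Finset.univ.filter fun i => V i ≤ w i / b ∧ f (S i) < τ).card := by
  rw [errCount, accepted, Multiset.countP_map, ← Finset.filter_val, Finset.card_val,
    Finset.filter_filter]
  simp [predSet]

/-- The bound sees a threshold only through which sample scores lie below it. -/
theorem URSCP_predSet_le_of_forall_lt {σ τ : ℝ≥0} (h : ∀ i, f (S i) < σ → f (S i) < τ) (δ : ℝ) :
    URSCP (predSet f σ) S V w b δ ≤ URSCP (predSet f τ) S V w b δ := by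
  classical
  refine cpUpper_mono _ δ ?_
  rw [errCount_predSet_accepted, errCount_predSet_accepted]
  exact Finset.card_le_card (Finset.monotone_filter_right _ fun i _ hi => ⟨hi.1, h i hi.2⟩)

/-- Above every score, all accepted examples are errors and the bound is `1 > ε`. -/
theorem bddAbove_feasible {δ ε : ℝ} (hδ : δ < 1) (hε : ε < 1) :
    BddAbove (feasible f S V w b δ ε) := by
  classical
  refine ⟨Finset.univ.sup fun i => f (S i), fun τ hτ => ?_⟩
  by_contra! hlt
  have hall (i : Fin m) : f (S i) < τ :=
    (Finset.le_sup (f := fun i => f (S i)) (Finset.mem_univ i)).trans_lt hlt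
  have hU : URSCP (predSet f τ) S V w b δ = 1 := by
    rw [URSCP, UCP, errCount_predSet_accepted, card_accepted]
    simp only [hall, and_true]
    exact cpUpper_self _ hδ
  exact absurd (hU ▸ hτ : (1 : ℝ) ≤ ε) (not_le.2 hε)

/-- Only finitely many scores lie strictly below the supremum, so some feasible threshold already
exceeds them all and has at least as many errors. -/
theorem isGreatest_tauHat {δ ε : ℝ} (hδ : δ < 1) (hε : ε < 1)
    (hne : (feasible f S V w b δ ε).Nonempty) :
    IsGreatest (feasible f S V w b δ ε) (tauHat f S V w b δ ε) := by
  classical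
  have hbdd := bddAbove_feasible f S V w b hδ hε
  refine ⟨?_, fun τ hτ => le_csSup hbdd hτ⟩
  obtain ⟨τ, hτ, hlt⟩ : ∃ τ ∈ feasible f S V w b δ ε,
      ∀ i, f (S i) < tauHat f S V w b δ ε → f (S i) < τ := by
    let I := Finset.univ.filter fun i => f (S i) < tauHat f S V w b δ ε
    rcases I.eq_empty_or_nonempty with hI | hI
    · obtain ⟨τ, hτ⟩ := hne
      refine ⟨τ, hτ, fun i hi => ?_⟩
      exact absurd (Finset.mem_filter.2 ⟨Finset.mem_univ i, hi⟩) (hI ▸ Finset.notMem_empty i)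
    · obtain ⟨j, hj, hmax⟩ := I.exists_max_image (fun i => f (S i)) hI
      obtain ⟨τ, hτ, hjτ⟩ := exists_lt_of_lt_csSup hne (Finset.mem_filter.1 hj).2
      exact ⟨τ, hτ, fun i hi =>
        (hmax i (Finset.mem_filter.2 ⟨Finset.mem_univ i, hi⟩)).trans_lt hjτ⟩
  exact (URSCP_predSet_le_of_forall_lt f S V w b hlt δ).trans hτ

end Thresholds

/-- If some sublevel set `{f < τ}` has measure exceeding `ε`, there is a measurable set of
measure at least `ε` contained in all of these. -/
theorem exists_subset_lt_of_measureReal_gt {Z : Type*} [MeasurableSpace Z] (Q : Measure Z)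
    [IsFiniteMeasure Q] {f : Z → ℝ≥0} (hf : Measurable f) {ε : ℝ}
    (hne : ∃ τ, ε < Q.real {z | f z < τ}) :
    ∃ B : Set Z, MeasurableSet B ∧ ε ≤ Q.real B ∧
      ∀ τ, ε < Q.real {z | f z < τ} → B ⊆ {z | f z < τ} := by
  set T : Set ℝ≥0 := {τ | ε < Q.real {z | f z < τ}} with hT
  have hlow (τ : ℝ≥0) (hτ : τ ∈ T) : sInf T ≤ τ := csInf_le (OrderBot.bddBelow _) hτ
  -- `B` is the open sublevel set at `sInf T` if the infimum is attained, otherwise the closed one,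
  -- where continuity from above gives only `≥ ε`.
  by_cases hmem : sInf T ∈ T
  · exact ⟨{z | f z < sInf T}, measurableSet_lt hf measurable_const, hmem.le,
      fun τ hτ z hz => lt_of_lt_of_le hz (hlow τ hτ)⟩
  · refine ⟨{z | f z ≤ sInf T}, measurableSet_le hf measurable_const, ?_, fun τ hτ z hz =>
      lt_of_le_of_lt hz ((hlow τ hτ).lt_of_ne fun h => hmem (h ▸ hτ))⟩
    have hinter : (⋂ τ > sInf T, {z | f z < τ}) = {z | f z ≤ sInf T} := by
      ext z
      simp only [Set.mem_iInter]
      exact ⟨fun h => le_of_forall_gt fun τ hτ => h τ hτ, fun h τ hτ => lt_of_le_of_lt h hτ⟩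
    have hlim := tendsto_measure_biInter_gt (μ := Q) (s := fun τ : ℝ≥0 => {z | f z < τ})
      (a := sInf T) (fun τ _ => (measurableSet_lt hf measurable_const).nullMeasurableSet)
      (fun σ τ _ hστ z hz => lt_of_lt_of_le hz hστ)
      ⟨sInf T + 1, lt_add_one _, measure_ne_top _ _⟩
    rw [hinter] at hlim
    refine ge_of_tendsto ((ENNReal.tendsto_toReal (measure_ne_top _ _)).comp hlim) ?_
    filter_upwards [self_mem_nhdsWithin] with τ hτ
    obtain ⟨σ, hσ, hστ⟩ := exists_lt_of_csInf_lt hne hτ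
    exact le_of_lt (lt_of_lt_of_le hσ (measureReal_mono fun z hz => lt_trans hz hστ))

open Classical in
/-- The binomial test applied to a sample and independent uniform variables has level `δ`. -/
theorem sampleLaw_binomCDF_le {X Y : Type*} [MeasurableSpace X] [MeasurableSpace Y]
    (P : Measure (X × Y)) [IsProbabilityMeasure P] {A E : Set ((X × Y) × ℝ)}
    (hA : MeasurableSet A) (hE : MeasurableSet E) (hEA : E ⊆ A) {θ δ : ℝ}
    (hθ : θ ∈ Set.Icc (0 : ℝ) 1) (hδ : 0 ≤ δ)
    (h : (P.prod unif01).real E = (P.prod unif01).real A * θ) (m : ℕ) :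
    (sampleLaw P m).real {SV | binomCDF
      (Finset.univ.filter fun i => (SV.1 i, SV.2 i) ∈ E).card
      (Finset.univ.filter fun i => (SV.1 i, SV.2 i) ∈ A).card θ ≤ δ} ≤ δ := by
  -- Regroups the sample and uniforms into i.i.d. pairs.
  have hmp := measurePreserving_arrowProdEquivProdArrow (X × Y) ℝ (Fin m) (fun _ => P)
    (fun _ => unif01)
  rw [sampleLaw, measureReal_def, ← hmp.measure_preimage_equiv]
  exact measureReal_pi_binomCDF_le (P.prod unif01) hA hE hEA hθ hδ h m

instance {X Y : Type*} [MeasurableSpace X] [MeasurableSpace Y] (P : Measure (X × Y))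
    [IsProbabilityMeasure P] (m : ℕ) : IsProbabilityMeasure (sampleLaw P m) := by
  unfold sampleLaw
  infer_instance

theorem expErr_predSet {X Y : Type*} [MeasurableSpace X] [MeasurableSpace Y]
    (Q : Measure (X × Y)) (f : X × Y → ℝ≥0) (τ : ℝ≥0) :
    expErr Q (predSet f τ) = Q.real {z | f z < τ} := by
  simp [expErr, predSet]

end RSCP

/-! ### Simultaneous guarantee for all thresholds up to `τ̂` -/

theorem theorem2 {X Y : Type*} [MeasurableSpace X] [MeasurableSpace Y]
    (P Q : Measure (X × Y)) [IsProbabilityMeasure P] [IsProbabilityMeasure Q]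
    (hshift : RSCP.CovariateShift P Q)
    (ν : Measure X) [SigmaFinite ν] (pX qX : X → ℝ≥0∞)
    (hpX : Measurable pX) (hqX : Measurable qX)
    (hP : P.fst = ν.withDensity pX) (hQ : Q.fst = ν.withDensity qX)
    (b : ℝ) (hb : ∀ x, RSCP.impWeight pX qX x ≤ ENNReal.ofReal b)
    (f : X × Y → ℝ≥0) (hf : Measurable f) (m : ℕ) (ε δ : ℝ)
    (hε : ε ∈ Set.Ioo (0 : ℝ) 1) (hδ : δ ∈ Set.Ioo (0 : ℝ) 1) :
    (∀ (S : Fin m → X × Y) (V : Fin m → ℝ),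
      (RSCP.feasible f S V (RSCP.weights pX qX S) b δ ε).Nonempty →
        IsGreatest (RSCP.feasible f S V (RSCP.weights pX qX S) b δ ε)
          (RSCP.tauHat f S V (RSCP.weights pX qX S) b δ ε)) ∧
    1 - δ ≤ (RSCP.sampleLaw P m).real
      {SV | ∀ τ : ℝ≥0, τ ≤ RSCP.tauHat f SV.1 SV.2 (RSCP.weights pX qX SV.1) b δ ε →
        RSCP.expErr Q (RSCP.predSet f τ) ≤ ε} := by
  refine ⟨fun S V hne => RSCP.isGreatest_tauHat f S V _ b hδ.2 hε.2 hne, ?_⟩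
  classical
  let w : X × Y → ℝ≥0∞ := fun z => RSCP.impWeight pX qX z.1
  have hwX : Measurable (RSCP.impWeight pX qX) := hqX.div hpX
  have hw : Measurable w := hwX.comp measurable_fst
  have hbw (z : X × Y) : w z ≤ ENNReal.ofReal b := hb z.1
  have hfin : ∫⁻ x, pX x ∂ν ≠ ∞ := by
    rw [← setLIntegral_univ, ← withDensity_apply _ MeasurableSet.univ, ← hP]
    exact measure_ne_top _ _
  have hPQ : Q = P.withDensity w := hshift.eq_withDensity hwX <| by
    rw [hP, hQ, RSCP.withDensity_impWeight ν hpX hqX hfin fun x =>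
      ((hb x).trans_lt ENNReal.ofReal_lt_top).ne]
  have hb0 : 0 < b := by
    by_contra! hb0
    have hw0 : w = 0 := funext fun z =>
      le_antisymm ((hbw z).trans_eq (ENNReal.ofReal_of_nonpos hb0)) zero_le
    exact IsProbabilityMeasure.ne_zero Q (by rw [hPQ, hw0, withDensity_zero])
  by_cases hbad : ∃ τ, ε < Q.real {z | f z < τ}
  · obtain ⟨B, hB, hεB, hBsub⟩ := RSCP.exists_subset_lt_of_measureReal_gt Q hf hbad
    let A := RSCP.acceptSet w b
    let E := A ∩ Prod.fst ⁻¹' B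
    have hA : MeasurableSet A := RSCP.measurableSet_acceptSet hw b
    have hEm : MeasurableSet E := hA.inter (measurable_fst hB)
    have hEreal : (P.prod RSCP.unif01).real E = b⁻¹ * Q.real B := by
      rw [RSCP.measureReal_acceptSet_inter P hw hb0 hbw hB, ← hPQ]
    have hAreal : (P.prod RSCP.unif01).real A = b⁻¹ := by
      have h := RSCP.measureReal_acceptSet_inter P hw hb0 hbw MeasurableSet.univ
      rwa [Set.preimage_univ, Set.inter_univ, ← hPQ, probReal_univ, mul_one] at h
    let good := {SV : (Fin m → X × Y) × (Fin m → ℝ) | ∀ τ : ℝ≥0,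
      τ ≤ RSCP.tauHat f SV.1 SV.2 (RSCP.weights pX qX SV.1) b δ ε →
        RSCP.expErr Q (RSCP.predSet f τ) ≤ ε}
    let reject := {SV : (Fin m → X × Y) × (Fin m → ℝ) | RSCP.binomCDF
      (Finset.univ.filter fun i => (SV.1 i, SV.2 i) ∈ E).card
      (Finset.univ.filter fun i => (SV.1 i, SV.2 i) ∈ A).card (Q.real B) ≤ δ}
    have hlevel : (RSCP.sampleLaw P m).real reject ≤ δ := by
      convert RSCP.sampleLaw_binomCDF_le P hA hEm Set.inter_subset_left
        ⟨measureReal_nonneg, measureReal_le_one⟩ hδ.1.le (hAreal ▸ hEreal) m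
    have hcover : good ∪ reject = Set.univ := by
      refine Set.eq_univ_of_forall fun ⟨S, V⟩ => or_iff_not_imp_left.2 fun hng => ?_
      simp only [good, Set.mem_ofPred_eq, not_forall, not_le, RSCP.expErr_predSet] at hng
      obtain ⟨τ, hτ, hετ⟩ := hng
      set τ' := RSCP.tauHat f S V (RSCP.weights pX qX S) b δ ε with hτ'
      have hετ' : ε < Q.real {z | f z < τ'} :=
        hετ.trans_le (measureReal_mono fun z hz => lt_of_lt_of_le hz hτ)
      -- In the infeasible case the default `τ̂ = 0` has zero error, hence cannot be bad.
      have hne : (RSCP.feasible f S V (RSCP.weights pX qX S) b δ ε).Nonempty := by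
        by_contra hemp
        rw [Set.not_nonempty_iff_eq_empty] at hemp
        have h0 : τ' = 0 := by rw [hτ', RSCP.tauHat, hemp, csSup_empty, bot_eq_zero]
        simp only [h0, not_lt_zero, Set.ofPred_false, measureReal_empty] at hετ'
        exact lt_asymm hε.1 hετ'
      have hU : RSCP.cpUpper _ _ δ ≤ ε :=
        (RSCP.isGreatest_tauHat f S V _ b hδ.2 hε.2 hne).1
      have hF := RSCP.binomCDF_le_of_cpUpper_le hε.2 hU hεB measureReal_le_one
      rw [RSCP.errCount_predSet_accepted, RSCP.card_accepted] at hF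
      refine le_trans (RSCP.binomCDF_mono_left _ ⟨measureReal_nonneg, measureReal_le_one⟩
        (Finset.card_le_card (Finset.monotone_filter_right _ fun i _ hi => ?_))) hF
      exact ⟨hi.1, hBsub τ' hετ' hi.2⟩
    -- Subadditivity on the cover avoids having to show `good` measurable.
    have hsum := measureReal_union_le (μ := RSCP.sampleLaw P m) good reject
    rw [hcover, probReal_univ] at hsum
    change 1 - δ ≤ (RSCP.sampleLaw P m).real good
    linarith
  · push Not at hbad
    simp only [RSCP.expErr_predSet, hbad, implies_true, Set.ofPred_true, probReal_univ]
    linarith [hδ.1]
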